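/- Let $M$ be a closed (compact, without boundary) smooth manifold of dimension $d\ge 2$ with a smooth Riemannian metric, and let $\mathrm{vol}_M$ be its Riemannian volume measure. Put $d'=d^2+d-1$. **Local family on $\mathbb{R}^d$.** Write $a\in\mathbb{R}^{d'}=\mathbb{R}^d\times\mathbb{R}^{d^2-1}$ as a vector $b_a\in\mathbb{R}^d$ together with a trace-free matrix $A'_a$: the entries of $A'_a$ other than the upper left one are the last $d^2-1$ coordinates of $a$, and the upper left entry is minus the sum of the other diagonal entries. Put $A_a=\exp(A'_a)\in \mathrm{SL}_d(\mathbb{R})$. Fix $R>1$ and $0<r\le 1$, and make the following choices. * A smooth map $a\mapsto b'_a\in\mathbb{R}^d$ on $(-r,r)^{d'}$ with $\exp\begin{pmatrix}A'_a&b'_a\\0&0\end{pmatrix}=\begin{pmatrix}A_a&b_a\\0&1\end{pmatrix}$ for all $a\in(-r,r)^{d'}$. It is assumed that $A_a(B_1(0))+b_a\subset B_R(0)$ for these $a$. Put $X_a(y)=A'_ay+b'_a$. * For $a\in(-r,r)^{d'}$, a $(d-2)$-form $\chi_a$ on $B_R(0)$ with $d\chi_a=\iota_{X_a}(dx_1\wedge\cdots\wedge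 dx_d)$ that is smooth in $(a,y)\in(-r,r)^{d'}\times B_R(0)$. * A smooth function $f\colon\mathbb{R}^d\to[0,1]$ with $f=1$ on $B_1(0)$ and with closed support contained in $B_R(0)$. Let $Y_a$ be the vector field on $\mathbb{R}^d$ with $\iota_{Y_a}(dx_1\wedge\cdots\wedge dx_d)=d(f\chi_a)$ (extended by $0$), and let $\psi^a$ be the time-one map of the flow of $Y_a$. **Perturbations on $M$.** Let $x_1,\dots,x_j\in M$ and let $\phi_i\colon U_i'\to B_R(0)$ be diffeomorphisms from open neighbourhoods $U'_i$ of $x_i$ with $\phi_i(x_i)=0$ that take vector fields that are divergence free for $\mathrm{vol}_M$ to divergence free vector fields. Assume that the sets $U_i=\phi_i^{-1}(B_{1/2}(0))$ cover $M$. Let $g_i^a\colon M\to M$ be $\phi_i^{-1}\circ\psi^a\circ\phi_i$ on $U_i'$ and the identity outside $U_i'$. **The measure $\mu$.** Let $f_0$ be a smooth diffeomorphism of $M$ that preserves $\mathrm{vol}_M$, let $0<\varepsilon<1/2$ with $\varepsilon<r$, let $p_0,\dots,p_j>0$ with $\sum_{i=0}^jp_i=1$, and let $$\mu=C\Big(p_0\,\delta_{f_0}+\sum_{i=1}^jp_i\int_{[-\varepsilon,\varepsilon]^{d'}}\delta_{g_i^a\circ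 f_0}\,da\Big),$$ where $C>0$ is the constant that makes $\mu$ a probability measure. **Theorem.** Let $\nu$ be a $\mu$-stationary Borel probability measure on $M$, that is, $\nu(E)=\int_M\mu(\{h: h(z)\in E\})\,d\nu(z)$ for all Borel sets $E\subseteq M$. Then $\nu=\rho+\nu'$ for some positive measures $\rho,\nu'$ on $M$ such that $\rho\ll\mathrm{vol}_M$ and $\rho\neq 0$. -/

import Mathlib

open Set MeasureTheory Manifold Function
open scoped ContDiff ENNReal Matrix

namespace RandomWalk

noncomputable section

/-! ### Forms and vector fields on `ℝ^d`, where `d = n + 2` -/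

/-- Euclidean space of dimension `d = n + 2 ≥ 2`. -/
abbrev Eucl (n : ℕ) : Type := EuclideanSpace ℝ (Fin (n + 2))

/-- The standard volume form `dx₁ ∧ ⋯ ∧ dx_d` of `ℝ^d`. -/
def volForm (n : ℕ) : Eucl n [⋀^Fin (n + 2)]→L[ℝ] ℝ :=
  { (Matrix.detRowAlternating (R := ℝ) (n := Fin (n + 2))).compLinearMap
      (WithLp.linearEquiv 2 ℝ (Fin (n + 2) → ℝ)).toLinearMap with
    cont := by
      change Continuous fun v : Fin (n + 2) → Eucl n =>
        Matrix.det (Matrix.of fun i j => (v i) j)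
      fun_prop }

/-- The interior product `ι_v (dx₁ ∧ ⋯ ∧ dx_d)`. -/
def interiorVol {n : ℕ} (v : Eucl n) : Eucl n [⋀^Fin (n + 1)]→L[ℝ] ℝ :=
  (volForm n).curryLeft v

/-- The vector `v` with `ι_v (dx₁ ∧ ⋯ ∧ dx_d) = η` (see `interiorVol_vectorOfForm`). -/
def vectorOfForm {n : ℕ} (η : Eucl n [⋀^Fin (n + 1)]→L[ℝ] ℝ) : Eucl n :=
  WithLp.toLp 2 fun i =>
    (-1 : ℝ) ^ (i : ℕ) * η fun k => EuclideanSpace.single (i.succAbove k) 1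

theorem interiorVol_apply {n : ℕ} (v : Eucl n) (w : Fin (n + 1) → Eucl n) :
    interiorVol v w = Matrix.det (Matrix.of fun i j => (Fin.cons v w : Fin (n + 2) → Eucl n) i j) :=
  rfl

theorem interiorVol_vectorOfForm {n : ℕ} (η : Eucl n [⋀^Fin (n + 1)]→L[ℝ] ℝ) :
    interiorVol (vectorOfForm η) = η := by
  apply ContinuousAlternatingMap.toAlternatingMap_injective
  refine Module.Basis.ext_alternating (EuclideanSpace.basisFun (Fin (n + 2)) ℝ).toBasis ?_
  intro s hs
  obtain ⟨i, hi⟩ : ∃ i, ∀ k, s k ≠ i := by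
    by_contra! h
    have := Fintype.card_le_of_surjective s h
    simp at this
  choose τ hτ using fun k => Fin.exists_succAbove_eq (hi k)
  have hτi : Injective τ := by
    intro a b hab
    apply hs
    rw [← hτ a, ← hτ b, hab]
  let σ : Equiv.Perm (Fin (n + 1)) := Equiv.ofBijective τ (Finite.injective_iff_bijective.1 hτi)
  have hsσ : (fun k => (EuclideanSpace.basisFun (Fin (n + 2)) ℝ).toBasis (s k)) =
      (fun k => (EuclideanSpace.single (i.succAbove k) (1 : ℝ) : Eucl n)) ∘ σ := by
    funext k
    simp [σ, hτ]
  rw [hsσ, AlternatingMap.map_perm, AlternatingMap.map_perm]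
  congr 1
  change interiorVol (vectorOfForm η) _ = η _
  rw [interiorVol_apply, Matrix.det_succ_row_zero, Finset.sum_eq_single i]
  · have h1 : (Matrix.of fun a b => (Fin.cons (vectorOfForm η)
        (fun k => (EuclideanSpace.single (i.succAbove k) (1 : ℝ) : Eucl n)) :
          Fin (n + 2) → Eucl n) a b).submatrix Fin.succ i.succAbove = 1 := by
      ext k l
      simp [Matrix.one_apply, eq_comm]
    rw [h1]
    have h2 : ((-1 : ℝ) ^ (i : ℕ)) * (-1 : ℝ) ^ (i : ℕ) = 1 := by
      rw [← mul_pow]; simp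
    simp only [Matrix.of_apply, Fin.cons_zero, vectorOfForm, Matrix.det_one, mul_one]
    rw [← mul_assoc, h2, one_mul]
  · intro j _ hj
    obtain ⟨l, hl⟩ := Fin.exists_succAbove_eq hj.symm
    rw [Matrix.det_eq_zero_of_column_eq_zero l, mul_zero]
    intro k
    simp [hl]
  · simp

/-- The time-one map of the flow of an autonomous vector field `Y` on `ℝ^d`: the point `y` goes to
`γ 1`, where `γ` is the integral curve of `Y` with `γ 0 = y`. (The vector fields below are smooth
with compact support, so that `γ` exists and is unique.) -/
def timeOneMap {n : ℕ} (Y : Eucl n → Eucl n) (y : Eucl n) : Eucl n :=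
  open Classical in
  if h : ∃ γ : ℝ → Eucl n, γ 0 = y ∧ IsIntegralCurve γ (fun _ => Y) then h.choose 1 else y

/-- The Euclidean divergence. -/
def euclDiv {n : ℕ} (V : Eucl n → Eucl n) (u : Eucl n) : ℝ :=
  ∑ i, fderiv ℝ V u (EuclideanSpace.single i 1) i

/-! ### The local family `ψ^a` -/

/-- The parameters `a`, with `d + (d² - 1)` real coordinates: the first `d` coordinates are the
translation part `b_a`, the others are the entries of the matrix `A'_a` except for its upper left
entry. -/
abbrev Param (n : ℕ) : Type :=
  Fin (n + 2) ⊕ {p : Fin (n + 2) × Fin (n + 2) // p ≠ (0, 0)} → ℝ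

/-- The translation part `b_a`. -/
def transl {n : ℕ} (a : Param n) : Fin (n + 2) → ℝ := fun i => a (Sum.inl i)

/-- The trace-free matrix `A'_a`: its upper left entry is minus the sum of the other diagonal
entries, the remaining entries are free. -/
def slMatrix {n : ℕ} (a : Param n) : Matrix (Fin (n + 2)) (Fin (n + 2)) ℝ :=
  Matrix.of fun i j =>
    if h : (i, j) ≠ (0, 0) then a (Sum.inr ⟨(i, j), h⟩)
    else -∑ k : Fin (n + 1), a (Sum.inr ⟨(k.succ, k.succ), by simp⟩)

/-- The matrix `A_a = exp A'_a`. -/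
def groupMatrix {n : ℕ} (a : Param n) : Matrix (Fin (n + 2)) (Fin (n + 2)) ℝ :=
  NormedSpace.exp (slMatrix a)

/-- The block matrix with rows `(A, b)` and `(0, c)`. -/
def affineMatrix {n : ℕ} (A : Matrix (Fin (n + 2)) (Fin (n + 2)) ℝ) (b : Fin (n + 2) → ℝ) (c : ℝ) :
    Matrix (Fin (n + 2) ⊕ Unit) (Fin (n + 2) ⊕ Unit) ℝ :=
  Matrix.fromBlocks A (Matrix.of fun i _ => b i) 0 (Matrix.of fun _ _ => c)

/-- The affine map `y ↦ A y + b` of `ℝ^d`. -/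
def affineMap {n : ℕ} (A : Matrix (Fin (n + 2)) (Fin (n + 2)) ℝ) (b : Fin (n + 2) → ℝ)
    (y : Eucl n) : Eucl n :=
  WithLp.toLp 2 (A *ᵥ y.ofLp + b)

/-- The parameters with all coordinates in `(-r, r)`. -/
def openCube (n : ℕ) (r : ℝ) : Set (Param n) := {a | ∀ i, a i ∈ Ioo (-r) r}

/-- The parameters with all coordinates in `[-ε, ε]`. -/
def closedCube (n : ℕ) (ε : ℝ) : Set (Param n) := {a | ∀ i, a i ∈ Icc (-ε) ε}

/-- The auxiliary choices made in `ℝ^d` in the construction of the family `ψ^a`. -/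
structure LocalChoices (n : ℕ) where
  /-- The radius of the large ball. -/
  R : ℝ
  one_lt_R : 1 < R
  /-- The construction is carried out for parameters in `(-r, r)^{d'}`. -/
  r : ℝ
  r_pos : 0 < r
  r_le_one : r ≤ 1
  /-- The vector `b'_a` with `exp (A'_a, b'_a; 0, 0) = (A_a, b_a; 0, 1)`. -/
  b' : Param n → Fin (n + 2) → ℝ
  contDiffOn_b' : ContDiffOn ℝ ∞ b' (openCube n r)
  exp_eq : ∀ a ∈ openCube n r,
    NormedSpace.exp (affineMatrix (slMatrix a) (b' a) 0) =
      affineMatrix (groupMatrix a) (transl a) 1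
  mapsTo_ball : ∀ a ∈ openCube n r,
    MapsTo (affineMap (groupMatrix a) (transl a)) (Metric.ball 0 1) (Metric.ball 0 R)
  /-- The primitive `χ_a` of `α_a = ι_{X_a} ω`, where `X_a (y) = A'_a y + b'_a`. -/
  χ : Param n → Eucl n → Eucl n [⋀^Fin n]→L[ℝ] ℝ
  contDiffOn_χ : ContDiffOn ℝ ∞ (uncurry χ) (openCube n r ×ˢ Metric.ball 0 R)
  extDeriv_χ : ∀ a ∈ openCube n r, ∀ y ∈ Metric.ball (0 : Eucl n) R,
    extDeriv (χ a) y = interiorVol (affineMap (slMatrix a) (b' a) y)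
  /-- The bump function. -/
  f : Eucl n → ℝ
  contDiff_f : ContDiff ℝ ∞ f
  f_mem : ∀ y, f y ∈ Icc (0 : ℝ) 1
  f_eq_one : ∀ y ∈ Metric.ball (0 : Eucl n) 1, f y = 1
  tsupport_f : tsupport f ⊆ Metric.ball 0 R

/-- The vector field `Y_a` given by `ι_{Y_a} ω = d (f χ_a)`. -/
def LocalChoices.field {n : ℕ} (L : LocalChoices n) (a : Param n) (y : Eucl n) : Eucl n :=
  vectorOfForm (extDeriv (fun u => L.f u • L.χ a u) y)

/-- The map `ψ^a`, the time-one map of the flow of `Y_a`. -/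
def LocalChoices.ψ {n : ℕ} (L : LocalChoices n) (a : Param n) : Eucl n → Eucl n :=
  timeOneMap (L.field a)

/-! ### The Riemannian volume and the random walk -/

section Manifold

variable {n : ℕ} {M : Type*} [TopologicalSpace M] [ChartedSpace (Eucl n) M]

/-- A smooth Riemannian metric on `M`. -/
abbrev RiemMetric (n : ℕ) (M : Type*) [TopologicalSpace M] [ChartedSpace (Eucl n) M]
    [IsManifold (𝓡 (n + 2)) ∞ M] : Type _ :=
  Bundle.ContMDiffRiemannianMetric (𝓡 (n + 2)) ∞ (Eucl n)
    (fun x : M => TangentSpace (𝓡 (n + 2)) x)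

/-- The coordinate vector field `∂_i` of the chart `φ`, at the point with coordinates `u`. -/
def coordVector (φ : OpenPartialHomeomorph M (Eucl n)) (u : Eucl n) (i : Fin (n + 2)) :
    TangentSpace (𝓡 (n + 2)) (φ.symm u) :=
  mfderiv (𝓡 (n + 2)) (𝓡 (n + 2)) φ.symm u
    (EuclideanSpace.single i (1 : ℝ) : Eucl n)

/-- The density `√(det (g_ij))` of the Riemannian volume in the chart `φ`. -/
def volDensity [IsManifold (𝓡 (n + 2)) ∞ M] (g : RiemMetric n M)
    (φ : OpenPartialHomeomorph M (Eucl n)) (u : Eucl n) : ℝ :=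
  √(Matrix.det (Matrix.of fun i j =>
    g.inner (φ.symm u) (coordVector φ u i) (coordVector φ u j)))

/-- The measure `√(det (g_ij)) dx` on the domain of the chart `φ`, extended by zero to `M`. -/
def chartVol [IsManifold (𝓡 (n + 2)) ∞ M] [MeasurableSpace M] (g : RiemMetric n M)
    (φ : OpenPartialHomeomorph M (Eucl n)) : Measure M :=
  ((volume.restrict φ.target).withDensity fun u => ENNReal.ofReal (volDensity g φ u)).map φ.symm

/-- The Riemannian volume measure `vol_M`: the least measure that dominates `√(det (g_ij)) dx` on
the domain of every smooth chart. By the change of variables formula these local measures agree on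
overlaps, hence `vol_M` restricts to `√(det (g_ij)) dx` on the domain of every chart. -/
def riemannianVolume [IsManifold (𝓡 (n + 2)) ∞ M] [MeasurableSpace M] (g : RiemMetric n M) :
    Measure M :=
  ⨆ φ ∈ IsManifold.maximalAtlas (𝓡 (n + 2)) ∞ M, chartVol g φ

/-- The chart `φ` takes smooth vector fields that are divergence free for the Riemannian volume to
vector fields that are divergence free on `ℝ^d`. In the chart, the field with coordinates `V` has
the Riemannian divergence `w⁻¹ div (w V)`, where `w = √(det (g_ij))`. -/
def PreservesDivFree [IsManifold (𝓡 (n + 2)) ∞ M] (g : RiemMetric n M)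
    (φ : OpenPartialHomeomorph M (Eucl n)) : Prop :=
  ∀ V : Eucl n → Eucl n, ContDiffOn ℝ ∞ V φ.target →
    (∀ u ∈ φ.target, (volDensity g φ u)⁻¹ * euclDiv (fun w => volDensity g φ w • V w) u = 0) →
    ∀ u ∈ φ.target, euclDiv V u = 0

/-- A chart `φ : U' → B_R(0)` centred at `x` that takes divergence free vector fields to divergence
free vector fields. -/
structure IsMoserChart [IsManifold (𝓡 (n + 2)) ∞ M] (g : RiemMetric n M) (R : ℝ) (x : M)
    (φ : OpenPartialHomeomorph M (Eucl n)) : Prop where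
  mem_maximalAtlas : φ ∈ IsManifold.maximalAtlas (𝓡 (n + 2)) ∞ M
  mem_source : x ∈ φ.source
  map_center : φ x = 0
  target_eq : φ.target = Metric.ball 0 R
  preservesDivFree : PreservesDivFree g φ

/-- The smaller neighbourhood `U = φ⁻¹ (B_{1/2}(0))`. -/
def innerNhd (φ : OpenPartialHomeomorph M (Eucl n)) : Set M :=
  φ.symm '' Metric.ball 0 (1 / 2)

/-- The map `g^a`, equal to `φ⁻¹ ∘ ψ^a ∘ φ` on `U'` and to the identity outside `U'`. -/
def perturbation (L : LocalChoices n) (φ : OpenPartialHomeomorph M (Eucl n)) (a : Param n)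
    (y : M) : M :=
  open Classical in if y ∈ φ.source then φ.symm (L.ψ a (φ y)) else y

/-- The measure `p₀ δ_{f₀} + ∑ i, p_i ∫_{[-ε, ε]^{d'}} δ_{g_i^a ∘ f₀} da`. -/
def unnormalizedLaw [MeasurableSpace M] (L : LocalChoices n) {j : ℕ}
    (φ : Fin j → OpenPartialHomeomorph M (Eucl n)) (f₀ : M → M) (ε p₀ : ℝ) (p : Fin j → ℝ) :
    Measure (M → M) :=
  ENNReal.ofReal p₀ • Measure.dirac f₀ +
    ∑ i, ENNReal.ofReal (p i) •
      (volume.restrict (closedCube n ε)).map fun a => perturbation L (φ i) a ∘ f₀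

/-- The law `μ` of the random walk, which is the measure above multiplied by the constant that
makes it a probability measure. It is regarded as a measure on the self-maps of `M` with the
σ-algebra generated by the evaluations at the points of `M`; on the group of smooth
diffeomorphisms, this σ-algebra induces the Borel σ-algebra of the `C^∞` topology. -/
def law [MeasurableSpace M] (L : LocalChoices n) {j : ℕ}
    (φ : Fin j → OpenPartialHomeomorph M (Eucl n)) (f₀ : M → M) (ε p₀ : ℝ) (p : Fin j → ℝ) :
    Measure (M → M) :=
  (unnormalizedLaw L φ f₀ ε p₀ p univ)⁻¹ • unnormalizedLaw L φ f₀ ε p₀ p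

end Manifold

/-- `ν` is `μ`-stationary: `(μ ∗ ν) (E) = ∫ μ {h | h z ∈ E} dν(z) = ν E` for every measurable
set `E`. -/
def IsStationary {M : Type*} [MeasurableSpace M] (μ : Measure (M → M)) (ν : Measure M) : Prop :=
  ∀ E : Set M, MeasurableSet E → ν E = ∫⁻ z, μ {h | h z ∈ E} ∂ν

end

end RandomWalk

/-! Stationarity is used only as an inequality: `ν` dominates the contribution of any single summand
of `μ`. The sets `f₀ ⁻¹' U_i` cover `M`, so one of them has positive `ν`-mass, and it suffices that
averaging the corresponding `g_i^a` over small `a` smooths this mass.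

In the chart `φ_i` the family is affine for small `a`. On the unit ball the cutoff is `1`, so `Y_a`
is the affine field `X_a`, whose time-one map is `y ↦ A_a y + b_a` by the exponential identity.
Since `X_0 = 0`, compactness keeps the trajectories from `B_{1/2}(0)` inside the unit ball up to
time one when `a` is near `0`. Hence `ψ^a y = A_a y + b_a` there (`eventually_ψ_eq_affineMap`).

For fixed `y` and fixed matrix part, `A_a y + b_a` is a translate of `b_a`, so by Fubini its law in
`a` is absolutely continuous (`volume_param_affineMap_eq_zero`). Averaging over `φ_i (f₀ z)` and
transporting back by `φ_i⁻¹` gives a nonzero `ρ ≪ vol_M` (`exists_absolutelyContinuous_part`); the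
transport preserves null sets because the volume density is positive in the chart. Then `c • ρ ≤ ν`
with `c > 0`, and `ν'` is the difference. -/

namespace RandomWalk

open Filter Topology NNReal

variable {n : ℕ}

/-! ### Flows of bounded Lipschitz vector fields -/

section ODE

variable {E : Type*} [NormedAddCommGroup E] [NormedSpace ℝ E]

/-- Two global integral curves of a Lipschitz field that meet are equal. -/
theorem integralCurve_unique {v : E → E} {K : ℝ≥0} (hv : LipschitzWith K v) {γ γ' : ℝ → E}
    (h : IsIntegralCurve γ fun _ => v) (h' : IsIntegralCurve γ' fun _ => v) {t₀ : ℝ}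
    (heq : γ t₀ = γ' t₀) : γ = γ' :=
  ODE_solution_unique_univ (v := fun _ => v) (s := fun _ => univ) (K := K)
    (fun _ => hv.lipschitzOnWith) (fun t => ⟨h t, mem_univ _⟩) (fun t => ⟨h' t, mem_univ _⟩) heq

/-- A bounded Lipschitz vector field is complete. -/
theorem exists_integralCurve_of_lipschitz_bounded [CompleteSpace E] {v : E → E} {K C : ℝ≥0}
    (hv : LipschitzWith K v) (hC : ∀ x, ‖v x‖ ≤ C) (x : E) :
    ∃ γ : ℝ → E, γ 0 = x ∧ IsIntegralCurve γ fun _ => v := by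
  have key : ∀ T : ℝ≥0, ∃ γ : ℝ → E, γ 0 = x ∧
      ∀ t ∈ Ioo (-(T : ℝ)) T, HasDerivAt γ (v (γ t)) t := by
    intro T
    have h0 : (0 : ℝ) ∈ Icc (-(T : ℝ)) T := by simp
    -- A solution moves by at most `C * T` in time `T`, so with this radius Picard–Lindelöf covers
    -- all of `[-T, T]` at once.
    have hPL : IsPicardLindelof (fun _ => v) (⟨0, h0⟩ : Icc (-(T : ℝ)) T) x (C * T) 0 C K :=
      { lipschitzOnWith := fun _ _ => hv.lipschitzOnWith
        continuousOn := fun _ _ => continuousOn_const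
        norm_le := fun _ _ y _ => hC y
        mul_max_le := by simp }
    obtain ⟨γ, h1, h2⟩ := hPL.exists_eq_forall_mem_Icc_hasDerivWithinAt₀
    exact ⟨γ, h1, fun t ht => (h2 t (Ioo_subset_Icc_self ht)).hasDerivAt
      (Icc_mem_nhds ht.1 ht.2)⟩
  choose γ hγ0 hγ using key
  have agree : ∀ S T : ℝ≥0, 0 < S → S ≤ T → EqOn (γ S) (γ T) (Ioo (-(S : ℝ)) S) := by
    intro S T hS hST
    have hST' : (S : ℝ) ≤ T := hST
    refine ODE_solution_unique_of_mem_Ioo (v := fun _ => v) (s := fun _ => univ) (K := K)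
      (t₀ := 0) (fun _ _ => hv.lipschitzOnWith) (by simpa using hS)
      (fun t ht => ⟨hγ S t ht, mem_univ _⟩) (fun t ht => ⟨hγ T t ?_, mem_univ _⟩)
      (by rw [hγ0, hγ0])
    exact ⟨by linarith [ht.1], by linarith [ht.2]⟩
  -- At time `t` the solution on an interval with `t` in its interior is used; by `agree` the pieces
  -- coincide near `t`.
  refine ⟨fun t => γ (‖t‖₊ + 1) t, by simpa using hγ0 _, fun t => ?_⟩
  have hmem : ∀ s : ℝ, s ∈ Ioo (-((‖s‖₊ + 1 : ℝ≥0) : ℝ)) ((‖s‖₊ + 1 : ℝ≥0) : ℝ) := by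
    intro s
    rw [mem_Ioo, ← abs_lt]
    simp
  have ht := hmem t
  refine (hγ (‖t‖₊ + 1) t ht).congr_of_eventuallyEq ?_
  filter_upwards [Ioo_mem_nhds ht.1 ht.2] with s hs
  rcases le_total (‖s‖₊ + 1) (‖t‖₊ + 1) with h | h
  · exact agree _ _ (by positivity) h (hmem s)
  · exact (agree _ _ (by positivity) h hs).symm

end ODE

/-- Uniqueness makes the choice of curve in `timeOneMap` immaterial. -/
theorem timeOneMap_eq {Y : Eucl n → Eucl n} {K : ℝ≥0} (hY : LipschitzWith K Y) {γ : ℝ → Eucl n}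
    (hγ : IsIntegralCurve γ fun _ => Y) : timeOneMap Y (γ 0) = γ 1 := by
  have h : ∃ δ : ℝ → Eucl n, δ 0 = γ 0 ∧ IsIntegralCurve δ (fun _ => Y) := ⟨γ, rfl, hγ⟩
  rw [timeOneMap, dif_pos h]
  exact congrFun (integralCurve_unique hY h.choose_spec.2 hγ h.choose_spec.1) 1

/-- The time-one map can be computed along a curve that solves the equation on `[0, 1]`. -/
theorem timeOneMap_eq_of_hasDerivAt {Y : Eucl n → Eucl n} {K C : ℝ≥0} (hY : LipschitzWith K Y)
    (hC : ∀ x, ‖Y x‖ ≤ C) {δ : ℝ → Eucl n} (hδ : ∀ t ∈ Icc (0 : ℝ) 1, HasDerivAt δ (Y (δ t)) t) :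
    timeOneMap Y (δ 0) = δ 1 := by
  obtain ⟨γ, h0, hγ⟩ := exists_integralCurve_of_lipschitz_bounded hY hC (δ 0)
  rw [← h0, timeOneMap_eq hY hγ]
  exact ODE_solution_unique (v := fun _ => Y) (fun _ => hY) hγ.continuous.continuousOn
    (fun t _ => (hγ t).hasDerivWithinAt)
    (fun t ht => (hδ t ht).continuousAt.continuousWithinAt)
    (fun t ht => (hδ t (Ico_subset_Icc_self ht)).hasDerivWithinAt) h0
    (right_mem_Icc.2 zero_le_one)

/-- The time-one map preserves every set off which the field vanishes. -/
theorem mapsTo_timeOneMap {Y : Eucl n → Eucl n} {K C : ℝ≥0} (hY : LipschitzWith K Y)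
    (hC : ∀ x, ‖Y x‖ ≤ C) {s : Set (Eucl n)} (hs : ∀ y ∉ s, Y y = 0) :
    MapsTo (timeOneMap Y) s s := by
  intro y hy
  obtain ⟨γ, rfl, hγ⟩ := exists_integralCurve_of_lipschitz_bounded hY hC y
  rw [timeOneMap_eq hY hγ]
  -- If `γ 1` were outside `s`, it would be a zero of `Y`, so `γ` would be constant by uniqueness
  -- and could not start in `s`.
  by_contra h1
  have hconst : IsIntegralCurve (fun _ => γ 1) fun _ => Y := fun t => by
    simpa [hs _ h1] using hasDerivAt_const t (γ 1)
  have : γ = fun _ => γ 1 := integralCurve_unique hY hγ hconst (t₀ := 1) rfl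
  rw [this] at hy
  exact h1 hy

/-- The time-one map depends continuously on the field, for uniform convergence. -/
theorem tendsto_timeOneMap {ι : Type*} {l : Filter ι} {Y : ι → Eucl n → Eucl n}
    {Z : Eucl n → Eucl n} {K C : ℝ≥0} (hZ : LipschitzWith K Z) (hC : ∀ x, ‖Z x‖ ≤ C)
    (hY : ∀ᶠ i in l, ∃ K' C' : ℝ≥0, LipschitzWith K' (Y i) ∧ ∀ x, ‖Y i x‖ ≤ C')
    (hlim : TendstoUniformly Y Z l) (y : Eucl n) :
    Tendsto (fun i => timeOneMap (Y i) y) l (𝓝 (timeOneMap Z y)) := by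
  obtain ⟨γ, rfl, hγ⟩ := exists_integralCurve_of_lipschitz_bounded hZ hC y
  rw [timeOneMap_eq hZ hγ, Metric.tendsto_nhds]
  intro ε hε
  have hg : Tendsto (fun δ => gronwallBound 0 K δ 1) (𝓝[>] 0) (𝓝 0) := by
    have h := (gronwallBound_continuous_ε 0 K 1).tendsto 0
    rw [gronwallBound_ε0_δ0] at h
    exact h.mono_left nhdsWithin_le_nhds
  obtain ⟨δ, hδε, (hδ : 0 < δ)⟩ := ((hg.eventually_lt_const hε).and self_mem_nhdsWithin).exists
  filter_upwards [hY, Metric.tendstoUniformly_iff.1 hlim δ hδ] with i ⟨K', C', hK', hC'⟩ hi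
  obtain ⟨γ', h0, hγ'⟩ := exists_integralCurve_of_lipschitz_bounded hK' hC' (γ 0)
  rw [← h0, timeOneMap_eq hK' hγ']
  -- Grönwall, with `γ'` as a `δ`-approximate solution for `Z`: only the Lipschitz constant of the
  -- limit enters, so those of the `Y i` may vary.
  have := dist_le_of_approx_trajectories_ODE (v := fun _ => Z) (K := K) (δ := 0) (εf := δ)
    (εg := 0) (a := 0) (b := 1) (fun _ => hZ) hγ'.continuous.continuousOn
    (fun t _ => (hγ' t).hasDerivWithinAt)
    (fun t _ => by simpa [dist_comm] using (hi (γ' t)).le)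
    hγ.continuous.continuousOn (fun t _ => (hγ t).hasDerivWithinAt) (fun t _ => by simp)
    (by simp [h0]) 1 (right_mem_Icc.2 zero_le_one)
  simp only [add_zero, sub_zero] at this
  exact this.trans_lt hδε

/-! ### Affine vector fields and the matrix exponential -/

section AffineFlow

open scoped Matrix.Norms.Operator

/-- The solution `t ↦ exp (t N) (y, 1)` of `γ' = A' γ + b'` with `γ 0 = y`, where
`N = (A', b'; 0, 0)`. -/
noncomputable def affineCurve (A' : Matrix (Fin (n + 2)) (Fin (n + 2)) ℝ) (b' : Fin (n + 2) → ℝ)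
    (y : Eucl n) (t : ℝ) : Eucl n :=
  WithLp.toLp 2 fun i =>
    (NormedSpace.exp (t • affineMatrix A' b' 0) *ᵥ Sum.elim y.ofLp fun _ => 1) (Sum.inl i)

theorem affineMatrix_mulVec_inl (A : Matrix (Fin (n + 2)) (Fin (n + 2)) ℝ) (b : Fin (n + 2) → ℝ)
    (c : ℝ) (w : Fin (n + 2) ⊕ Unit → ℝ) (i : Fin (n + 2)) :
    (affineMatrix A b c *ᵥ w) (Sum.inl i) =
      (A *ᵥ (w ∘ Sum.inl)) i + b i * w (Sum.inr ()) := by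
  simp [affineMatrix, Matrix.mulVec, dotProduct, Fintype.sum_sum_type]

theorem affineMatrix_mulVec_inr (A : Matrix (Fin (n + 2)) (Fin (n + 2)) ℝ) (b : Fin (n + 2) → ℝ)
    (c : ℝ) (w : Fin (n + 2) ⊕ Unit → ℝ) :
    (affineMatrix A b c *ᵥ w) (Sum.inr ()) = c * w (Sum.inr ()) := by
  simp [affineMatrix, Matrix.mulVec, dotProduct, Fintype.sum_sum_type]

theorem affineCurve_zero (A' : Matrix (Fin (n + 2)) (Fin (n + 2)) ℝ) (b' : Fin (n + 2) → ℝ)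
    (y : Eucl n) : affineCurve A' b' y 0 = y := by
  ext i
  simp [affineCurve]

theorem affineCurve_one {A' A : Matrix (Fin (n + 2)) (Fin (n + 2)) ℝ} {b' b : Fin (n + 2) → ℝ}
    (h : NormedSpace.exp (affineMatrix A' b' 0) = affineMatrix A b 1) (y : Eucl n) :
    affineCurve A' b' y 1 = affineMap A b y := by
  ext i
  simp only [affineCurve, affineMap, one_smul, h, affineMatrix_mulVec_inl]
  simp [Function.comp_def]

theorem hasDerivAt_exp_smul_mulVec {ι : Type*} [Fintype ι] [DecidableEq ι] (N : Matrix ι ι ℝ)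
    (w : ι → ℝ) (t : ℝ) :
    HasDerivAt (fun s : ℝ => NormedSpace.exp (s • N) *ᵥ w)
      (N *ᵥ (NormedSpace.exp (t • N) *ᵥ w)) t := by
  rw [Matrix.mulVec_mulVec]
  exact (LinearMap.toContinuousLinearMap ((Matrix.mulVecBilin ℝ ℝ).flip w :
    Matrix ι ι ℝ →ₗ[ℝ] ι → ℝ)).hasFDerivAt.comp_hasDerivAt t
      (hasDerivAt_exp_smul_const' (𝕂 := ℝ) N t)

theorem hasDerivAt_affineCurve (A' : Matrix (Fin (n + 2)) (Fin (n + 2)) ℝ)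
    (b' : Fin (n + 2) → ℝ) (y : Eucl n) (t : ℝ) :
    HasDerivAt (affineCurve A' b' y) (affineMap A' b' (affineCurve A' b' y t)) t := by
  set N := affineMatrix A' b' 0 with hN
  set v : Fin (n + 2) ⊕ Unit → ℝ := Sum.elim y.ofLp fun _ => 1 with hv
  have hd := fun t => hasDerivAt_pi.1 (hasDerivAt_exp_smul_mulVec N v t)
  -- The last row of `N` vanishes, so the last coordinate keeps its initial value `1` and the linear
  -- system restricts to the affine one.
  have hr : ∀ t : ℝ, (NormedSpace.exp (t • N) *ᵥ v) (Sum.inr ()) = 1 := by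
    intro t
    have h0 : ∀ s, HasDerivAt (fun s : ℝ => (NormedSpace.exp (s • N) *ᵥ v) (Sum.inr ())) 0 s := by
      intro s
      have := hd s (Sum.inr ())
      rwa [hN, affineMatrix_mulVec_inr, zero_mul] at this
    have := is_const_of_deriv_eq_zero (fun s => (h0 s).differentiableAt) (fun s => (h0 s).deriv) t 0
    simpa [hv] using this
  have h1 : HasDerivAt (fun s i => (NormedSpace.exp (s • N) *ᵥ v) (Sum.inl i))
      (fun i => (N *ᵥ (NormedSpace.exp (t • N) *ᵥ v)) (Sum.inl i)) t :=
    hasDerivAt_pi.2 fun i => hd t (Sum.inl i)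
  have h2 := (PiLp.continuousLinearEquiv 2 ℝ
    fun _ : Fin (n + 2) => ℝ).symm.toContinuousLinearMap.hasFDerivAt.comp_hasDerivAt t h1
  refine h2.congr_deriv (PiLp.ext fun i => ?_)
  change (affineMatrix A' b' 0 *ᵥ (NormedSpace.exp (t • N) *ᵥ v)) (Sum.inl i) =
    (affineMap A' b' (affineCurve A' b' y t)) i
  rw [affineMatrix_mulVec_inl, hr, mul_one]
  rfl

theorem continuous_affineCurve :
    Continuous fun p : (Matrix (Fin (n + 2)) (Fin (n + 2)) ℝ × (Fin (n + 2) → ℝ)) × ℝ × Eucl n =>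
      affineCurve p.1.1 p.1.2 p.2.2 p.2.1 := by
  have h1 : Continuous fun p : (Matrix (Fin (n + 2)) (Fin (n + 2)) ℝ × (Fin (n + 2) → ℝ)) ×
      ℝ × Eucl n => NormedSpace.exp (p.2.1 • affineMatrix p.1.1 p.1.2 0) := by
    refine (NormedSpace.exp_continuous (𝔸 := Matrix (Fin (n + 2) ⊕ Unit) (Fin (n + 2) ⊕ Unit) ℝ)).comp ?_
    refine continuous_snd.fst.smul ?_
    refine Continuous.matrix_fromBlocks continuous_fst.fst ?_ continuous_const continuous_const
    exact continuous_matrix fun i _ => (continuous_apply i).comp continuous_fst.snd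
  have h2 : Continuous fun p : (Matrix (Fin (n + 2)) (Fin (n + 2)) ℝ × (Fin (n + 2) → ℝ)) ×
      ℝ × Eucl n => (Sum.elim p.2.2.ofLp fun _ => 1 : Fin (n + 2) ⊕ Unit → ℝ) := by
    refine continuous_pi fun i => ?_
    rcases i with i | i
    · simp only [Sum.elim_inl]; fun_prop
    · exact continuous_const
  refine (PiLp.continuous_toLp 2 _).comp (continuous_pi fun i => ?_)
  exact (continuous_apply (Sum.inl i)).comp (h1.matrix_mulVec h2)

/-- With zero linear part the curve from `0` is `t • b'`, which must return to `0` at time one. This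
yields `X_0 = 0`. -/
theorem eq_zero_of_exp_affineMatrix_eq_one {b' : Fin (n + 2) → ℝ}
    (h : NormedSpace.exp (affineMatrix 0 b' 0) = affineMatrix 1 0 1) : b' = 0 := by
  have hd : ∀ t, HasDerivAt (fun t => affineCurve 0 b' 0 t - t • WithLp.toLp 2 b') 0 t := by
    intro t
    have := (hasDerivAt_affineCurve 0 b' 0 t).fun_sub
      ((hasDerivAt_id' t).smul_const (WithLp.toLp 2 b'))
    exact this.congr_deriv (by simp [affineMap])
  have := is_const_of_deriv_eq_zero (fun s => (hd s).differentiableAt) (fun s => (hd s).deriv) 1 0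
  rw [affineCurve_one h, affineCurve_zero] at this
  simpa [affineMap] using this

end AffineFlow

/-! ### Forms versus fields, and continuity of the parameter maps -/

/-- Expanding along the row `v`, only column `i` survives when `e_i` is omitted; its minor is the
identity and the two signs cancel. -/
theorem vectorOfForm_interiorVol (v : Eucl n) : vectorOfForm (interiorVol v) = v := by
  ext i
  change (-1 : ℝ) ^ (i : ℕ) * interiorVol v _ = _
  rw [interiorVol_apply, Matrix.det_succ_row_zero, Finset.sum_eq_single i]
  · have h1 : (Matrix.of fun a b => (Fin.cons v
        (fun k => (EuclideanSpace.single (i.succAbove k) (1 : ℝ) : Eucl n)) :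
          Fin (n + 2) → Eucl n) a b).submatrix Fin.succ i.succAbove = 1 := by
      ext k l
      simp [Matrix.one_apply, eq_comm]
    rw [h1, ← mul_assoc, ← mul_assoc, ← mul_pow]
    simp
  · intro j _ hj
    obtain ⟨l, hl⟩ := Fin.exists_succAbove_eq hj.symm
    rw [Matrix.det_eq_zero_of_column_eq_zero l, mul_zero]
    intro k
    simp [hl]
  · simp

theorem contDiff_vectorOfForm {k : WithTop ℕ∞} :
    ContDiff ℝ k (vectorOfForm : Eucl n [⋀^Fin (n + 1)]→L[ℝ] ℝ → Eucl n) := by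
  rw [contDiff_euclidean]
  intro i
  exact contDiff_const.mul (ContinuousAlternatingMap.apply ℝ (Eucl n) ℝ
    fun k => EuclideanSpace.single (i.succAbove k) 1).contDiff

theorem isOpen_openCube (r : ℝ) : IsOpen (openCube n r) := by
  have : openCube n r = univ.pi fun _ => Ioo (-r) r := by
    ext; simp only [openCube, mem_ofPred_eq, mem_univ_pi]
  rw [this]
  exact isOpen_set_pi finite_univ fun _ _ => isOpen_Ioo

theorem closedCube_subset_openCube {ε r : ℝ} (h : ε < r) : closedCube n ε ⊆ openCube n r :=
  fun _ ha i => ⟨by linarith [(ha i).1], by linarith [(ha i).2]⟩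

theorem continuous_transl : Continuous (transl : Param n → Fin (n + 2) → ℝ) :=
  continuous_pi fun i => continuous_apply (Sum.inl i)

theorem continuous_slMatrix : Continuous (slMatrix : Param n → _) := by
  refine continuous_matrix fun i j => ?_
  simp only [slMatrix, Matrix.of_apply]
  split_ifs <;> fun_prop

open scoped Matrix.Norms.Operator in
theorem continuous_groupMatrix : Continuous (groupMatrix : Param n → _) :=
  (NormedSpace.exp_continuous (𝔸 := Matrix (Fin (n + 2)) (Fin (n + 2)) ℝ)).comp continuous_slMatrix

theorem slMatrix_zero : slMatrix (0 : Param n) = 0 := by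
  ext i j
  simp [slMatrix]

/-! ### The fields `Y_a` and the maps `ψ^a` -/

namespace LocalChoices

variable (L : LocalChoices n)

theorem zero_mem_openCube : (0 : Param n) ∈ openCube n L.r :=
  fun _ => ⟨by simpa using L.r_pos, L.r_pos⟩

theorem isCompact_tsupport_f : IsCompact (tsupport L.f) :=
  (isCompact_closedBall (0 : Eucl n) L.R).of_isClosed_subset (isClosed_tsupport _)
    (L.tsupport_f.trans Metric.ball_subset_closedBall)

theorem contDiffAt_uncurry_field {a : Param n} (ha : a ∈ openCube n L.r) {y : Eucl n}
    (hy : y ∈ Metric.ball (0 : Eucl n) L.R) : ContDiffAt ℝ 1 (uncurry L.field) (a, y) := by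
  have hχ : ContDiffAt ℝ ∞ (uncurry L.χ) (a, y) := L.contDiffOn_χ.contDiffAt
    (((isOpen_openCube L.r).prod Metric.isOpen_ball).mem_nhds ⟨ha, hy⟩)
  -- The point `y` enters twice, as part of the parameter and as the variable `u`, which is the form
  -- required for differentiating in `u` and evaluating at `q.2`. Class `C²` leaves `C¹` after the
  -- exterior derivative.
  have hF : ContDiffAt ℝ 2 (uncurry fun (q : Param n × Eucl n) (u : Eucl n) => L.f u • L.χ q.1 u)
      ((a, y), y) := by
    have h1 : ContDiffAt ℝ ∞ (fun q : (Param n × Eucl n) × Eucl n => L.χ q.1.1 q.2) ((a, y), y) :=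
      ContDiffAt.comp ((a, y), y) (f := fun q : (Param n × Eucl n) × Eucl n => (q.1.1, q.2)) hχ
        (by fun_prop)
    have h2 : ContDiffAt ℝ ∞ (fun q : (Param n × Eucl n) × Eucl n => L.f q.2) ((a, y), y) :=
      L.contDiff_f.contDiffAt.comp _ contDiffAt_snd
    exact (h2.smul h1).of_le ENat.LEInfty.out
  have h3 : ContDiffAt ℝ 1 (fun q : Param n × Eucl n =>
      fderiv ℝ (fun u => L.f u • L.χ q.1 u) q.2) (a, y) :=
    ContDiffAt.fderiv (f := fun (q : Param n × Eucl n) (u : Eucl n) => L.f u • L.χ q.1 u)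
      (g := Prod.snd) (n := 2) hF contDiffAt_snd (by norm_num)
  have h4 : ContDiffAt ℝ 1 (fun q : Param n × Eucl n =>
      extDeriv (fun u => L.f u • L.χ q.1 u) q.2) (a, y) := by
    have := (ContinuousAlternatingMap.alternatizeUncurryFinCLM (n := n) ℝ (Eucl n)
      ℝ).contDiff.contDiffAt.comp (a, y) h3
    simpa only [comp_def, extDeriv,
      ContinuousAlternatingMap.alternatizeUncurryFinCLM_apply] using this
  exact contDiff_vectorOfForm.contDiffAt.comp _ h4

theorem field_eq_zero (a : Param n) {y : Eucl n} (hy : y ∉ tsupport L.f) : L.field a y = 0 := by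
  have h : (fun u => L.f u • L.χ a u) =ᶠ[𝓝 y] fun _ => 0 := by
    filter_upwards [(isClosed_tsupport L.f).isOpen_compl.mem_nhds hy] with u hu
    rw [image_eq_zero_of_notMem_tsupport hu, zero_smul]
  rw [field, h.extDeriv_eq]
  ext i
  simp [vectorOfForm, extDeriv, ContinuousAlternatingMap.alternatizeUncurryFin_apply]

theorem contDiff_field {a : Param n} (ha : a ∈ openCube n L.r) : ContDiff ℝ 1 (L.field a) := by
  rw [contDiff_iff_contDiffAt]
  intro y
  by_cases hy : y ∈ tsupport L.f
  · exact ContDiffAt.comp (g := uncurry L.field) (f := fun u => (a, u)) y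
      (L.contDiffAt_uncurry_field ha (L.tsupport_f hy)) (by fun_prop)
  · refine (contDiffAt_const (c := (0 : Eucl n))).congr_of_eventuallyEq ?_
    filter_upwards [(isClosed_tsupport L.f).isOpen_compl.mem_nhds hy] with u hu
    exact L.field_eq_zero a hu

theorem hasCompactSupport_field (a : Param n) : HasCompactSupport (L.field a) :=
  HasCompactSupport.intro L.isCompact_tsupport_f fun _ hy => L.field_eq_zero a hy

theorem field_lipschitz_bounded {a : Param n} (ha : a ∈ openCube n L.r) :
    ∃ K C : ℝ≥0, LipschitzWith K (L.field a) ∧ ∀ y, ‖L.field a y‖ ≤ C := by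
  obtain ⟨K, hK⟩ := (L.contDiff_field ha).lipschitzWith_of_hasCompactSupport
    (L.hasCompactSupport_field a) one_ne_zero
  obtain ⟨C, hC⟩ := (L.hasCompactSupport_field a).exists_bound_of_continuous
    (L.contDiff_field ha).continuous
  exact ⟨K, C.toNNReal, hK, fun y => (hC y).trans (Real.le_coe_toNNReal C)⟩

/-- All the fields vanish off the same compact set, so joint continuity suffices. -/
theorem tendstoUniformly_field {a : Param n} (ha : a ∈ openCube n L.r) :
    TendstoUniformly L.field (L.field a) (𝓝 a) := by
  rw [Metric.tendstoUniformly_iff]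
  intro ε hε
  have h : ∀ᶠ a' in 𝓝 a, ∀ y ∈ tsupport L.f, dist (L.field a y) (L.field a' y) < ε := by
    refine L.isCompact_tsupport_f.eventually_forall_of_forall_eventually fun y hy => ?_
    have h1 : ContinuousAt (uncurry L.field) (a, y) :=
      (L.contDiffAt_uncurry_field ha (L.tsupport_f hy)).continuousAt
    have h2 : ContinuousAt (fun q : Param n × Eucl n => L.field a q.2) (a, y) :=
      (L.contDiff_field ha).continuous.continuousAt.comp continuousAt_snd
    refine (h2.dist h1).eventually_lt_const ?_
    simpa using hε
  filter_upwards [h] with a' ha' y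
  by_cases hy : y ∈ tsupport L.f
  · exact ha' y hy
  · simpa [L.field_eq_zero _ hy] using hε

theorem continuousOn_ψ (y : Eucl n) : ContinuousOn (fun a => L.ψ a y) (openCube n L.r) := by
  intro a ha
  obtain ⟨K, C, hK, hC⟩ := L.field_lipschitz_bounded ha
  refine ContinuousAt.continuousWithinAt (tendsto_timeOneMap hK hC ?_
    (L.tendstoUniformly_field ha) y)
  filter_upwards [(isOpen_openCube L.r).mem_nhds ha] with a' ha'
  exact L.field_lipschitz_bounded ha'

theorem mapsTo_ψ {a : Param n} (ha : a ∈ openCube n L.r) :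
    MapsTo (L.ψ a) (Metric.ball 0 L.R) (Metric.ball 0 L.R) := by
  obtain ⟨K, C, hK, hC⟩ := L.field_lipschitz_bounded ha
  exact mapsTo_timeOneMap hK hC fun y hy => L.field_eq_zero a fun h => hy (L.tsupport_f h)

theorem field_eq_affineMap {a : Param n} (ha : a ∈ openCube n L.r) {y : Eucl n}
    (hy : y ∈ Metric.ball (0 : Eucl n) 1) :
    L.field a y = affineMap (slMatrix a) (L.b' a) y := by
  have h : (fun u => L.f u • L.χ a u) =ᶠ[𝓝 y] L.χ a := by
    filter_upwards [Metric.isOpen_ball.mem_nhds hy] with u hu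
    rw [L.f_eq_one u hu, one_smul]
  rw [field, h.extDeriv_eq, L.extDeriv_χ a ha y (Metric.ball_subset_ball L.one_lt_R.le hy),
    vectorOfForm_interiorVol]

theorem b'_zero : L.b' 0 = 0 := by
  have h := L.exp_eq 0 L.zero_mem_openCube
  rw [groupMatrix, slMatrix_zero, NormedSpace.exp_zero] at h
  exact eq_zero_of_exp_affineMatrix_eq_one h

/-- For small parameters, `ψ^a` is affine on the ball of radius `1 / 2`. -/
theorem eventually_ψ_eq_affineMap : ∀ᶠ a in 𝓝 (0 : Param n),
    ∀ y ∈ Metric.ball (0 : Eucl n) (1 / 2),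
      L.ψ a y = affineMap (groupMatrix a) (transl a) y ∧
        affineMap (groupMatrix a) (transl a) y ∈ Metric.ball (0 : Eucl n) 1 := by
  have hopen := (isOpen_openCube L.r).mem_nhds L.zero_mem_openCube
  -- At `a = 0` the curves are constant, hence stay in the closed ball of radius `1 / 2`.
  -- Compactness of times and starting points extends the confinement to the open unit ball to all
  -- `a` near `0`.
  have h : ∀ᶠ a in 𝓝 (0 : Param n),
      ∀ q ∈ Icc (0 : ℝ) 1 ×ˢ Metric.closedBall (0 : Eucl n) (1 / 2),
        affineCurve (slMatrix a) (L.b' a) q.2 q.1 ∈ Metric.ball (0 : Eucl n) 1 := by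
    refine (isCompact_Icc.prod (isCompact_closedBall _ _)).eventually_forall_of_forall_eventually
      fun q hq => ?_
    have hb : ContinuousAt L.b' 0 := (L.contDiffOn_b'.contDiffAt hopen).continuousAt
    have hc : ContinuousAt (fun z : Param n × ℝ × Eucl n =>
        affineCurve (slMatrix z.1) (L.b' z.1) z.2.2 z.2.1) (0, q) :=
      ContinuousAt.comp (f := fun z : Param n × ℝ × Eucl n => ((slMatrix z.1, L.b' z.1), z.2))
        continuous_affineCurve.continuousAt
        (((continuous_slMatrix.continuousAt.comp continuousAt_fst).prodMk
          (ContinuousAt.comp (g := L.b') (f := Prod.fst) hb continuousAt_fst)).prodMk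
            continuousAt_snd)
    refine hc.eventually_mem (Metric.isOpen_ball.mem_nhds ?_)
    have hq' : affineCurve (0 : Matrix (Fin (n + 2)) (Fin (n + 2)) ℝ) 0 q.2 q.1 = q.2 := by
      ext i
      have : affineMatrix (0 : Matrix (Fin (n + 2)) (Fin (n + 2)) ℝ) 0 0 = 0 := by
        ext (i | i) (j | j) <;> simp [affineMatrix]
      simp [affineCurve, this]
    have h2 := hq.2
    simp only [slMatrix_zero, L.b'_zero, hq', mem_ball_zero_iff]
    rw [mem_closedBall_zero_iff] at h2
    linarith
  filter_upwards [h, hopen] with a ha hacube y hy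
  have hy' := Metric.ball_subset_closedBall hy
  have hone := affineCurve_one (L.exp_eq a hacube) y
  obtain ⟨K, C, hK, hC⟩ := L.field_lipschitz_bounded hacube
  constructor
  -- The affine curve stays where `Y_a = X_a`, so it is also a trajectory of `Y_a` on `[0, 1]`.
  · have := timeOneMap_eq_of_hasDerivAt hK hC (δ := affineCurve (slMatrix a) (L.b' a) y)
      fun t ht => by
        rw [L.field_eq_affineMap hacube (ha (t, y) ⟨ht, hy'⟩)]
        exact hasDerivAt_affineCurve _ _ _ _
    rwa [affineCurve_zero, hone] at this
  · rw [← hone]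
    exact ha (1, y) ⟨right_mem_Icc.2 zero_le_one, hy'⟩

end LocalChoices

/-! ### Averaging affine maps over the parameters -/

theorem groupMatrix_congr {a a' : Param n} (h : ∀ i, a (Sum.inr i) = a' (Sum.inr i)) :
    groupMatrix a = groupMatrix a' := by
  simp only [groupMatrix, slMatrix, h]

theorem continuous_affineMap_param :
    Continuous fun q : Eucl n × Param n => affineMap (groupMatrix q.2) (transl q.2) q.1 := by
  refine (PiLp.continuous_toLp 2 _).comp (Continuous.add ?_ (continuous_transl.comp continuous_snd))
  exact (continuous_groupMatrix.comp continuous_snd).matrix_mulVec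
    ((PiLp.continuous_ofLp 2 _).comp continuous_fst)

/-- For a fixed point `y`, the law of `A_a y + b_a` is absolutely continuous. -/
theorem volume_param_affineMap_eq_zero {s : Set (Eucl n)} (hs : MeasurableSet s)
    (h0 : volume s = 0) (y : Eucl n) :
    volume {a : Param n | affineMap (groupMatrix a) (transl a) y ∈ s} = 0 := by
  set S := {a : Param n | affineMap (groupMatrix a) (transl a) y ∈ s} with hS
  have hSm : MeasurableSet S :=
    (continuous_affineMap_param.comp (continuous_const.prodMk continuous_id)).measurable hs
  -- Fubini for `a = (b, c)`, with `b` the translation and `c` the matrix coordinates: for fixed `c`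
  -- the map `b ↦ A y + b` preserves Lebesgue measure, so every slice is null.
  have hmp := volume_measurePreserving_sumPiEquivProdPi_symm
    (fun _ : Fin (n + 2) ⊕ {p : Fin (n + 2) × Fin (n + 2) // p ≠ (0, 0)} => ℝ)
  rw [← hmp.measure_preimage hSm.nullMeasurableSet]
  rw [Measure.volume_eq_prod, Measure.prod_apply_symm (hmp.measurable hSm)]
  refine lintegral_eq_zero_of_ae_eq_zero (Eventually.of_forall fun c => ?_)
  let a₀ : Param n := Sum.elim (fun _ => 0) c
  have hT := (PiLp.volume_preserving_toLp (Fin (n + 2))).comp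
    (measurePreserving_add_left volume (groupMatrix a₀ *ᵥ y.ofLp))
  have hpre := hT.measure_preimage hs.nullMeasurableSet
  rw [h0] at hpre
  refine (congrArg volume ?_).trans hpre
  ext b
  have hg : groupMatrix ((MeasurableEquiv.sumPiEquivProdPi
    (fun _ : Fin (n + 2) ⊕ {p : Fin (n + 2) × Fin (n + 2) // p ≠ (0, 0)} => ℝ)).symm (b, c)) =
      groupMatrix a₀ := groupMatrix_congr fun _ => rfl
  simp only [mem_preimage, hS, mem_ofPred_eq, hg]
  rfl

/-- Averaging the affine maps over the parameters gives an absolutely continuous measure. -/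
theorem map_affineMap_absolutelyContinuous (η : Measure (Eucl n)) [SFinite η]
    (Q : Set (Param n)) :
    (η.prod (volume.restrict Q)).map
      (fun q => affineMap (groupMatrix q.2) (transl q.2) q.1) ≪ volume := by
  refine Measure.AbsolutelyContinuous.mk fun s hs h0 => ?_
  rw [Measure.map_apply continuous_affineMap_param.measurable hs,
    Measure.prod_apply (continuous_affineMap_param.measurable hs)]
  refine lintegral_eq_zero_of_ae_eq_zero (Eventually.of_forall fun y => ?_)
  exact Measure.absolutelyContinuous_of_le Measure.restrict_le_self
    (volume_param_affineMap_eq_zero hs h0 y)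

/-! ### The Riemannian volume in a chart -/

theorem aemeasurable_chart_symm {M : Type*} [TopologicalSpace M] [MeasurableSpace M]
    [BorelSpace M] (φ : OpenPartialHomeomorph M (Eucl n)) (μ : Measure (Eucl n)) :
    AEMeasurable φ.symm (μ.restrict φ.target) :=
  φ.continuousOn_symm.aemeasurable φ.open_target.measurableSet

theorem dotProduct_gram_mulVec {V ι : Type*} [AddCommGroup V] [Module ℝ V] [TopologicalSpace V]
    [Fintype ι] (B : V →L[ℝ] V →L[ℝ] ℝ) (v : ι → V) (x : ι → ℝ) :
    star x ⬝ᵥ ((Matrix.of fun i j => B (v i) (v j)) *ᵥ x) =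
      B (∑ i, x i • v i) (∑ i, x i • v i) := by
  simp only [map_sum, map_smul, _root_.sum_apply, _root_.smul_apply,
    dotProduct, Matrix.mulVec, Matrix.of_apply, smul_eq_mul, star_trivial, Finset.mul_sum]
  rw [Finset.sum_comm]
  exact Finset.sum_congr rfl fun i _ => Finset.sum_congr rfl fun j _ => by ring

section Manifold

variable {M : Type*} [TopologicalSpace M] [ChartedSpace (Eucl n) M]

theorem mfderiv_chart_symm_injective {φ : OpenPartialHomeomorph M (Eucl n)}
    (hφ : φ ∈ IsManifold.maximalAtlas (𝓡 (n + 2)) ∞ M) {u : Eucl n} (hu : u ∈ φ.target) :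
    Injective (mfderiv (𝓡 (n + 2)) (𝓡 (n + 2)) φ.symm u) := by
  have h : φ.MDifferentiable (𝓡 (n + 2)) (𝓡 (n + 2)) :=
    ⟨(contMDiffOn_of_mem_maximalAtlas hφ).mdifferentiableOn (by simp),
      (contMDiffOn_symm_of_mem_maximalAtlas hφ).mdifferentiableOn (by simp)⟩
  exact h.symm.mfderiv_injective hu

/-- The derivative of `φ.symm` is injective, so the metric is positive on nonzero combinations of
the coordinate vectors and their Gram matrix is positive definite. -/
theorem volDensity_pos [IsManifold (𝓡 (n + 2)) ∞ M] (g : RiemMetric n M) {φ : OpenPartialHomeomorph M (Eucl n)}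
    (hφ : φ ∈ IsManifold.maximalAtlas (𝓡 (n + 2)) ∞ M) {u : Eucl n} (hu : u ∈ φ.target) :
    0 < volDensity g φ u := by
  refine Real.sqrt_pos.2 (Matrix.PosDef.det_pos (Matrix.PosDef.of_dotProduct_mulVec_pos ?_ ?_))
  · ext i j
    simp [g.symm _ (coordVector φ u i)]
  · intro x hx
    set D := mfderiv (𝓡 (n + 2)) (𝓡 (n + 2)) φ.symm u with hD
    have hv : D (WithLp.toLp 2 x : Eucl n) = ∑ i, x i • coordVector φ u i := by
      have hx' : (WithLp.toLp 2 x : Eucl n) = ∑ i, x i • (EuclideanSpace.single i (1 : ℝ)) := by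
        ext k
        simp [Finset.sum_apply, Pi.single_apply]
      rw [hx']
      exact (map_sum D _ _).trans (Finset.sum_congr rfl fun i _ => map_smul D _ _)
    have hne : D (WithLp.toLp 2 x : Eucl n) ≠ 0 := by
      intro h0
      have := mfderiv_chart_symm_injective hφ hu (h0.trans (map_zero D).symm)
      exact hx ((WithLp.toLp_eq_zero 2).1 this)
    have hpos := g.pos _ _ hne
    rw [hv] at hpos
    rwa [← dotProduct_gram_mulVec] at hpos

theorem continuousOn_volDensity [IsManifold (𝓡 (n + 2)) ∞ M] (g : RiemMetric n M) {φ : OpenPartialHomeomorph M (Eucl n)}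
    (hφ : φ ∈ IsManifold.maximalAtlas (𝓡 (n + 2)) ∞ M) :
    ContinuousOn (volDensity g φ) φ.target := by
  have hs : ContMDiffOn (𝓡 (n + 2)) (𝓡 (n + 2)) 1 φ.symm φ.target :=
    (contMDiffOn_symm_of_mem_maximalAtlas hφ).of_le (by simp)
  -- The coordinate fields are images of constant sections under the tangent map of `φ.symm`.
  have hv : ∀ i, ContMDiffOn (𝓡 (n + 2)) (𝓡 (n + 2)).tangent 0 (fun u =>
      (⟨φ.symm u, coordVector φ u i⟩ : TangentBundle (𝓡 (n + 2)) M)) φ.target := by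
    intro i
    have h1 := hs.contMDiffOn_tangentMapWithin (m := 0) (by simp) φ.open_target.uniqueMDiffOn
    have h2 : ContMDiff (𝓡 (n + 2)) (𝓡 (n + 2)).tangent 0 (fun u : Eucl n =>
        (⟨u, (EuclideanSpace.single i (1 : ℝ) : Eucl n)⟩ : TangentBundle (𝓡 (n + 2)) (Eucl n))) :=
      contMDiff_vectorSpace_iff_contDiff.2 contDiff_const
    refine (h1.comp h2.contMDiffOn (fun u hu => hu)).congr fun u hu => ?_
    simp only [comp_def, tangentMapWithin, mfderivWithin_of_isOpen φ.open_target hu]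
    rfl
  have hg : ∀ i j, ContinuousOn (fun u =>
      g.inner (φ.symm u) (coordVector φ u i) (coordVector φ u j)) φ.target := by
    intro i j u hu
    have hb : ContMDiffWithinAt (𝓡 (n + 2)) (𝓡 (n + 2)) 0 φ.symm φ.target u :=
      (hs u hu).of_le (by simp)
    have : ContMDiffWithinAt (𝓡 (n + 2)) ((𝓡 (n + 2)).prod 𝓘(ℝ)) 0
        (fun u => Bundle.TotalSpace.mk' ℝ (E := Bundle.Trivial M ℝ) (φ.symm u)
          (g.inner (φ.symm u) (coordVector φ u i) (coordVector φ u j))) φ.target u := by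
      apply ContMDiffWithinAt.clm_bundle_apply₂ (F₁ := Eucl n) (F₂ := Eucl n)
      · exact ContMDiffAt.comp_contMDiffWithinAt u (g.contMDiff.contMDiffAt.of_le (by simp)) hb
      · exact hv i u hu
      · exact hv j u hu
    simp only [Bundle.contMDiffWithinAt_totalSpace] at this
    exact this.2.continuousWithinAt
  refine Real.continuous_sqrt.comp_continuousOn ?_
  rw [continuousOn_iff_continuous_domRestrict]
  refine Continuous.matrix_det (continuous_matrix fun i j => ?_)
  exact continuousOn_iff_continuous_domRestrict.1 (hg i j)

/-- A set that is null for the Riemannian volume is null in every chart. -/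
theorem volume_target_inter_preimage_eq_zero [IsManifold (𝓡 (n + 2)) ∞ M]
    [MeasurableSpace M] [BorelSpace M] (g : RiemMetric n M)
    {φ : OpenPartialHomeomorph M (Eucl n)}
    (hφ : φ ∈ IsManifold.maximalAtlas (𝓡 (n + 2)) ∞ M) {s : Set M} (hs : MeasurableSet s)
    (h0 : riemannianVolume g s = 0) : (volume.restrict φ.target) (φ.symm ⁻¹' s) = 0 := by
  have hle : chartVol g φ ≤ riemannianVolume g :=
    le_iSup₂ (f := fun φ (_ : φ ∈ IsManifold.maximalAtlas (𝓡 (n + 2)) ∞ M) => chartVol g φ) φ hφ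
  have h1 : chartVol g φ s = 0 := le_antisymm ((hle s).trans h0.le) zero_le
  have hac : (volume.restrict φ.target).withDensity
      (fun u => ENNReal.ofReal (volDensity g φ u)) ≪ volume.restrict φ.target :=
    withDensity_absolutelyContinuous _ _
  have hd : AEMeasurable (fun u => ENNReal.ofReal (volDensity g φ u))
      (volume.restrict φ.target) :=
    ((continuousOn_volDensity g hφ).aemeasurable φ.open_target.measurableSet).ennreal_ofReal
  rw [chartVol, Measure.map_apply_of_aemeasurable ((aemeasurable_chart_symm φ _).mono_ac hac) hs]
    at h1
  refine withDensity_absolutelyContinuous' hd ?_ h1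
  filter_upwards [ae_restrict_mem φ.open_target.measurableSet] with u hu
  simpa using volDensity_pos g hφ hu

end Manifold

/-! ### The random walk on `M` -/

theorem isCompact_closedCube (ε : ℝ) : IsCompact (closedCube n ε) := by
  have : closedCube n ε = univ.pi fun _ => Icc (-ε) ε := by
    ext; simp only [closedCube, mem_ofPred_eq, mem_univ_pi]
  rw [this]
  exact isCompact_univ_pi fun _ => isCompact_Icc

section Walk

variable {M : Type*} [TopologicalSpace M]

theorem continuousOn_perturbation (L : LocalChoices n) {φ : OpenPartialHomeomorph M (Eucl n)}
    (hφ : φ.target = Metric.ball 0 L.R) (y : M) :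
    ContinuousOn (fun a => perturbation L φ a y) (openCube n L.r) := by
  by_cases hy : y ∈ φ.source
  · simp only [perturbation, if_pos hy]
    refine φ.continuousOn_symm.comp (L.continuousOn_ψ (φ y)) fun a ha => ?_
    rw [hφ]
    exact L.mapsTo_ψ ha (hφ ▸ φ.map_source hy)
  · simp only [perturbation, if_neg hy]
    exact continuousOn_const

theorem isOpen_innerNhd {φ : OpenPartialHomeomorph M (Eucl n)}
    (hφ : Metric.ball 0 (1 / 2) ⊆ φ.target) : IsOpen (innerNhd φ) :=
  φ.isOpen_image_symm_of_subset_target Metric.isOpen_ball hφ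

variable [MeasurableSpace M]

theorem unnormalizedLaw_univ_ne_top (L : LocalChoices n) {j : ℕ}
    (φ : Fin j → OpenPartialHomeomorph M (Eucl n)) (f₀ : M → M) (ε p₀ : ℝ) (p : Fin j → ℝ) :
    unnormalizedLaw L φ f₀ ε p₀ p univ ≠ ⊤ := by
  have : IsFiniteMeasure ((volume : Measure (Param n)).restrict (closedCube n ε)) :=
    ⟨by simpa using (isCompact_closedCube ε).measure_lt_top⟩
  simp only [unnormalizedLaw, Measure.add_apply, Measure.smul_apply, Measure.finsetSum_apply,
    smul_eq_mul]
  refine ENNReal.add_ne_top.2 ⟨ENNReal.mul_ne_top ENNReal.ofReal_ne_top (measure_ne_top _ _),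
    ENNReal.sum_ne_top.2 fun i _ => ENNReal.mul_ne_top ENNReal.ofReal_ne_top (measure_ne_top _ _)⟩

variable [BorelSpace M]

/-- Without this measurability the `Measure.map` in `unnormalizedLaw` would be zero by definition.
It follows from continuity of `a ↦ ψ^a y`, as the σ-algebra on self-maps is generated by
evaluations. -/
theorem aemeasurable_perturbation_comp (L : LocalChoices n)
    {φ : OpenPartialHomeomorph M (Eucl n)} (hφ : φ.target = Metric.ball 0 L.R) (f₀ : M → M)
    {ε : ℝ} (hε : ε < L.r) :
    AEMeasurable (fun a => perturbation L φ a ∘ f₀) (volume.restrict (closedCube n ε)) := by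
  refine aemeasurable_restrict_of_measurable_subtype (isCompact_closedCube ε).isClosed.measurableSet ?_
  refine measurable_pi_iff.2 fun z => Continuous.measurable ?_
  exact continuousOn_iff_continuous_domRestrict.1
    ((continuousOn_perturbation L hφ (f₀ z)).mono (closedCube_subset_openCube hε))

/-- All summands of `μ` but the `i`-th are discarded. -/
theorem le_law_apply (L : LocalChoices n) {j : ℕ}
    (φ : Fin j → OpenPartialHomeomorph M (Eucl n)) (i : Fin j)
    (hφ : (φ i).target = Metric.ball 0 L.R) (f₀ : M → M) {ε : ℝ} (hε : ε < L.r) (p₀ : ℝ)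
    (p : Fin j → ℝ) (z : M) (s : Set M) :
    (unnormalizedLaw L φ f₀ ε p₀ p univ)⁻¹ * ENNReal.ofReal (p i) *
        volume.restrict (closedCube n ε) {a | perturbation L (φ i) a (f₀ z) ∈ s} ≤
      law L φ f₀ ε p₀ p {h | h z ∈ s} := by
  rw [law, Measure.smul_apply, smul_eq_mul, mul_assoc]
  gcongr
  rw [unnormalizedLaw, Measure.add_apply, Measure.finsetSum_apply]
  refine le_trans ?_ le_add_self
  refine le_trans ?_ (Finset.single_le_sum (fun _ _ => zero_le) (Finset.mem_univ i))
  rw [Measure.smul_apply, smul_eq_mul]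
  gcongr
  exact Measure.le_map_apply (aemeasurable_perturbation_comp L hφ f₀ hε) _

/-- If the points carried by `f₀` into `innerNhd φ` have positive mass, then the average of the
laws of `g^a (f₀ z)` dominates a nonzero absolutely continuous measure. -/
theorem exists_absolutelyContinuous_part [ChartedSpace (Eucl n) M]
    [IsManifold (𝓡 (n + 2)) ∞ M] (g : RiemMetric n M) (L : LocalChoices n)
    {φ : OpenPartialHomeomorph M (Eucl n)} {x : M} (hφ : IsMoserChart g L.R x φ)
    {f₀ : M → M} (hf₀ : Continuous f₀) {ε : ℝ} (hε : 0 < ε)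
    (ν : Measure M) [IsFiniteMeasure ν] (hν : ν (f₀ ⁻¹' innerNhd φ) ≠ 0) :
    ∃ ρ : Measure M, ρ ≪ riemannianVolume g ∧ ρ ≠ 0 ∧ ∀ s, MeasurableSet s →
      ρ s ≤ ∫⁻ z, volume.restrict (closedCube n ε) {a | perturbation L φ a (f₀ z) ∈ s} ∂ν := by
  have hball1 : Metric.ball (0 : Eucl n) 1 ⊆ φ.target := by
    rw [hφ.target_eq]
    exact Metric.ball_subset_ball L.one_lt_R.le
  have hballh : Metric.ball (0 : Eucl n) (1 / 2) ⊆ φ.target :=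
    (Metric.ball_subset_ball (by norm_num)).trans hball1
  have hcube : ∀ᶠ a in 𝓝 (0 : Param n), a ∈ closedCube n ε :=
    mem_of_superset ((isOpen_openCube ε).mem_nhds fun i => by simpa using hε)
      fun a ha i => Ioo_subset_Icc_self (ha i)
  -- `Q` is an open neighbourhood of `0` in the cube on which `ψ^a` is affine; openness gives it
  -- positive volume, so that `ρ ≠ 0`.
  obtain ⟨Q, hQ, hQo, hQ0⟩ := eventually_nhds_iff.1 (hcube.and L.eventually_ψ_eq_affineMap)
  set Z := f₀ ⁻¹' innerNhd φ with hZ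
  have hZm : MeasurableSet Z := ((isOpen_innerNhd hballh).preimage hf₀).measurableSet
  have hZ' : ∀ z ∈ Z, f₀ z ∈ φ.source ∧ φ (f₀ z) ∈ Metric.ball (0 : Eucl n) (1 / 2) := by
    rintro z ⟨u, hu, huz⟩
    rw [← huz, φ.right_inv (hballh hu)]
    exact ⟨φ.map_target (hballh hu), hu⟩
  have hηm : AEMeasurable (fun z => φ (f₀ z)) (ν.restrict Z) :=
    (φ.continuousOn.comp hf₀.continuousOn fun z hz => (hZ' z hz).1).aemeasurable hZm
  set η := (ν.restrict Z).map fun z => φ (f₀ z) with hη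
  set F : Eucl n × Param n → Eucl n := fun q => affineMap (groupMatrix q.2) (transl q.2) q.1 with hF
  have hFm : Measurable F := continuous_affineMap_param.measurable
  set m := (η.prod (volume.restrict Q)).map F with hm
  have hmac : m ≪ volume := map_affineMap_absolutelyContinuous η Q
  classical
  -- A Borel extension of `φ.symm`; the value `x` off the target does not matter, since `m` is
  -- carried by the target (`hmt`).
  set τ : Eucl n → M := φ.target.piecewise φ.symm fun _ => x with hτ
  have hτm : Measurable τ :=
    φ.continuousOn_symm.measurable_piecewise continuousOn_const φ.open_target.measurableSet
  have hint : ∀ s, MeasurableSet s → m s =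
      ∫⁻ z in Z, volume.restrict Q {a | F (φ (f₀ z), a) ∈ s} ∂ν := by
    intro s hs
    rw [hm, Measure.map_apply hFm hs, Measure.prod_apply (hFm hs), hη,
      lintegral_map' (measurable_measure_prodMk_left (hFm hs)).aemeasurable hηm]
    rfl
  have hmt : m φ.targetᶜ = 0 := by
    rw [hint _ φ.open_target.measurableSet.compl]
    refine (setLIntegral_congr_fun hZm fun z hz => ?_).trans lintegral_zero
    rw [Measure.restrict_apply' hQo.measurableSet]
    refine (congrArg volume ?_).trans measure_empty
    ext a
    simp only [mem_inter_iff, mem_ofPred_eq, mem_compl_iff, mem_empty_iff_false, iff_false,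
      not_and]
    exact fun h ha => h (hball1 ((hQ a ha).2 _ (hZ' z hz).2).2)
  refine ⟨m.map τ, Measure.AbsolutelyContinuous.mk fun s hs h0 => ?_, ?_, fun s hs => ?_⟩
  · rw [Measure.map_apply hτm hs, ← measure_inter_add_sdiff _ φ.open_target.measurableSet]
    have h1 : m (τ ⁻¹' s \ φ.target) = 0 := measure_mono_null (fun _ h => h.2) hmt
    have h2 : τ ⁻¹' s ∩ φ.target ⊆ φ.symm ⁻¹' s ∩ φ.target := by
      rintro u ⟨hu, hut⟩
      simp only [hτ, mem_preimage, piecewise_eq_of_mem _ _ _ hut] at hu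
      exact ⟨hu, hut⟩
    have h3 := volume_target_inter_preimage_eq_zero g hφ.mem_maximalAtlas hs h0
    rw [Measure.restrict_apply' φ.open_target.measurableSet] at h3
    rw [h1, add_zero]
    exact measure_mono_null h2 (hmac h3)
  · rw [Ne, ← Measure.measure_univ_eq_zero, Measure.map_apply hτm .univ, preimage_univ,
      hm, Measure.map_apply hFm .univ, preimage_univ, ← univ_prod_univ, Measure.prod_prod,
      hη, Measure.map_apply_of_aemeasurable hηm .univ]
    simpa using ⟨hν, (hQo.measure_pos volume ⟨0, hQ0⟩).ne'⟩
  · rw [Measure.map_apply hτm hs, hint _ (hτm hs)]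
    -- Restricting to `z ∈ Z` and `a ∈ Q` only lowers the right side, and there `g^a (f₀ z)` is
    -- `φ.symm` of the affine image.
    refine (setLIntegral_mono' hZm fun z hz => ?_).trans (setLIntegral_le_lintegral _ _)
    rw [Measure.restrict_apply' hQo.measurableSet]
    refine (measure_mono ?_).trans (Measure.le_restrict_apply _ _)
    rintro a ⟨ha, haQ⟩
    refine ⟨?_, (hQ a haQ).1⟩
    obtain ⟨h1, h2⟩ := (hQ a haQ).2 _ (hZ' z hz).2
    simp only [mem_ofPred_eq, mem_preimage, hF, hτ, piecewise_eq_of_mem _ _ _ (hball1 h2)] at ha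
    rw [mem_ofPred_eq, perturbation, if_pos (hZ' z hz).1, h1]
    exact ha

end Walk

end RandomWalk

/-! ### The absolutely continuous part of a stationary measure -/

theorem mainTheorem6 {n : ℕ} {M : Type*} [TopologicalSpace M] [T2Space M] [CompactSpace M]
    [ChartedSpace (RandomWalk.Eucl n) M] [IsManifold (𝓡 (n + 2)) ∞ M]
    [MeasurableSpace M] [BorelSpace M]
    (g : RandomWalk.RiemMetric n M)
    (L : RandomWalk.LocalChoices n)
    (j : ℕ) (x : Fin j → M) (φ : Fin j → OpenPartialHomeomorph M (RandomWalk.Eucl n))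
    (hφ : ∀ i, RandomWalk.IsMoserChart g L.R (x i) (φ i))
    (hcover : ⋃ i, RandomWalk.innerNhd (φ i) = Set.univ)
    (f₀ : Diffeomorph (𝓡 (n + 2)) (𝓡 (n + 2)) M M ∞)
    (hf₀ : MeasurePreserving f₀ (RandomWalk.riemannianVolume g) (RandomWalk.riemannianVolume g))
    (ε : ℝ) (hε : 0 < ε) (hε_half : ε < 1 / 2) (hεr : ε < L.r)
    (p₀ : ℝ) (p : Fin j → ℝ) (hp₀ : 0 < p₀) (hp : ∀ i, 0 < p i) (hsum : p₀ + ∑ i, p i = 1)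
    (ν : Measure M) [IsProbabilityMeasure ν]
    (hν : RandomWalk.IsStationary (RandomWalk.law L φ f₀ ε p₀ p) ν) :
    ∃ ρ ν' : Measure M,
      ν = ρ + ν' ∧ ρ ≪ RandomWalk.riemannianVolume g ∧ ρ ≠ 0 := by
  obtain ⟨i, hi⟩ : ∃ i, ν (f₀ ⁻¹' RandomWalk.innerNhd (φ i)) ≠ 0 := by
    by_contra! h
    have h1 := measure_iUnion_null h
    rw [← Set.preimage_iUnion, hcover, Set.preimage_univ] at h1
    exact IsProbabilityMeasure.ne_zero ν (Measure.measure_univ_eq_zero.1 h1)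
  obtain ⟨ρ, hac, hne, hle⟩ :=
    RandomWalk.exists_absolutelyContinuous_part g L (hφ i) f₀.continuous hε ν hi
  set c := (RandomWalk.unnormalizedLaw L φ f₀ ε p₀ p Set.univ)⁻¹ * ENNReal.ofReal (p i)
  -- The normalizing constant is nonzero because the unnormalized law has finite mass.
  have hc : c ≠ 0 := mul_ne_zero
    (ENNReal.inv_ne_zero.2 (RandomWalk.unnormalizedLaw_univ_ne_top L φ f₀ ε p₀ p))
    (by simpa using hp i)
  have hcν : c • ρ ≤ ν := by
    refine Measure.le_iff.2 fun s hs => ?_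
    rw [Measure.smul_apply, smul_eq_mul, hν s hs]
    calc c * ρ s ≤ c * ∫⁻ z, volume.restrict (RandomWalk.closedCube n ε)
            {a | RandomWalk.perturbation L (φ i) a (f₀ z) ∈ s} ∂ν := by gcongr; exact hle s hs
      -- In this direction the constant moves inside the integral without measurability of the
      -- integrand.
      _ ≤ ∫⁻ z, c * volume.restrict (RandomWalk.closedCube n ε)
            {a | RandomWalk.perturbation L (φ i) a (f₀ z) ∈ s} ∂ν := lintegral_const_mul_le _ _
      _ ≤ _ := lintegral_mono fun z =>
        RandomWalk.le_law_apply L φ i (hφ i).target_eq f₀ hεr p₀ p z s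
  -- Finiteness lets the subtraction of measures be undone by addition.
  have : IsFiniteMeasure (c • ρ) := isFiniteMeasure_of_le ν hcν
  refine ⟨c • ρ, ν - c • ρ, ?_, hac.smul_left c, ?_⟩
  · rw [add_comm, Measure.sub_add_cancel_of_le hcν]
  · intro h
    apply hne
    rw [← Measure.measure_univ_eq_zero] at h ⊢
    simpa [hc] using h
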